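/- Let $d\ge 1$, $\kappa_1,\kappa_2>0$, and let $\omega\subset\mathbb{R}^d$ be a connected, unbounded open set that is periodic with respect to $\mathbb{Z}^d$, such that $\mathbb{R}^d\setminus\omega=\bigcup_k \overline{F}_k$, where $\{F_k\}$ is a (possibly empty) family of bounded Lipschitz domains with connected boundaries and $\inf_{k\neq m}\operatorname{dist}(F_k,F_m)>0$. Set $F=\bigcup_k F_k=\mathbb{R}^d\setminus\overline{\omega}$ and, for $0<\delta<\infty$, let $\Lambda_{\delta^2}=\delta^2$ on $F$ and $\Lambda_{\delta^2}=1$ on $\mathbb{R}^d\setminus F$. Let $A=(a_{ij}^{\alpha\beta}(x))$, $1\le i,j,\alpha,\beta\le d$, be real, bounded, measurable and $\mathbb{Z}^d$-periodic, and assume that $a_{ij}^{\alpha\beta}(x)=a_{ji}^{\beta\alpha}(x)=a_{\alpha j}^{i\beta}(x)$ and $$\kappa_1|\xi|^2\le a_{ij}^{\alpha\beta}(x)\,\xi_i^\alpha\xi_j^\beta\le\kappa_2|\xi|^2$$ for all $x\in\mathbb{R}^d$ and all symmetric matrices $\xi=(\xi_i^\alpha)\in\mathbb{R}^{d\times d}$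 (repeated indices are summed). Let $\mathcal{L}_\delta=-\operatorname{div}(\Lambda_{\delta^2}A\nabla)$ and $Q_R=(-R/2,R/2)^d$. A function $u\in H^1(Q_R;\mathbb{R}^d)$ is a weak solution of $\mathcal{L}_\delta(u)=0$ in $Q_R$ if $\int_{Q_R}\Lambda_{\delta^2}\,a_{ij}^{\alpha\beta}\,\partial_j u^\beta\,\partial_i v^\alpha\,dx=0$ for all $v\in C_c^\infty(Q_R;\mathbb{R}^d)$ (equivalently, for all $v\in H^1_0(Q_R;\mathbb{R}^d)$). **Theorem 3.3.** For every real $\ell\ge1$ there is a constant $C>0$, depending only on $d$, $\kappa_1$, $\kappa_2$, $\ell$ and $\omega$ (in particular not on $\delta$, $R$, $A$ or $u$), such that for every $1<\delta<\infty$, every $R\ge32$, every $A$ as above, and every weak solution $u\in H^1(Q_R;\mathbb{R}^d)$ of $\mathcal{L}_\delta(u)=0$ in $Q_R$, $$\int_{Q_{R/2}}|\nabla u|^2\,dx\le\frac{C}{R^2}\int_{Q_R}|u|^2\,dx+\frac{C}{R^{2\ell}}\int_{Q_R}|\nabla u|^2\,dx .$$ -/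

import Mathlib

open MeasureTheory

noncomputable section

namespace HighContrast

/-- The Euclidean space `ℝ^d`. -/
abbrev Sp (d : ℕ) : Type := EuclideanSpace ℝ (Fin d)

/-- An integer vector, seen as a point of `ℝ^d`. -/
def latticeVec {d : ℕ} (z : Fin d → ℤ) : Sp d := WithLp.toLp 2 (fun i => (z i : ℝ))

/-- The open cube `Q_R = (-R/2, R/2)^d`. -/
def cube (d : ℕ) (R : ℝ) : Set (Sp d) := {x | ∀ i, x i ∈ Set.Ioo (-(R / 2)) (R / 2)}

/-! ### Geometry of the matrix and of the inclusions -/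

/-- Near each of its boundary points the set `D` is the open region above the graph of a Lipschitz
function over a hyperplane `n^⊥`. Only the values of `ψ` on the hyperplane matter; every Lipschitz
function on the hyperplane extends to the whole space. -/
def HasLipschitzBoundary {d : ℕ} (D : Set (Sp d)) : Prop :=
  ∀ x₀ ∈ frontier D, ∃ (n : Sp d) (ψ : Sp d → ℝ) (K : NNReal) (r : ℝ),
    ‖n‖ = 1 ∧ LipschitzWith K ψ ∧ 0 < r ∧
      ∀ y ∈ Metric.ball x₀ r, (y ∈ D ↔ ψ (y - inner ℝ n y • n) < inner ℝ n y)

/-- A bounded Lipschitz domain (non-empty, open, connected) with connected boundary. -/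
structure IsInclusion {d : ℕ} (D : Set (Sp d)) : Prop where
  isOpen : IsOpen D
  isConnected : IsConnected D
  isBounded : Bornology.IsBounded D
  lipschitz : HasLipschitzBoundary D
  connected_frontier : IsConnected (frontier D)

/-- The standing assumptions on the matrix `ω`: it is open, connected, unbounded and 1-periodic, and
its complement is the union of the closures of a (possibly empty) family of bounded Lipschitz
domains with connected boundaries, at uniformly positive mutual distances. -/
structure IsPeriodicMatrix {d : ℕ} (ω : Set (Sp d)) : Prop where
  isOpen : IsOpen ω
  isConnected : IsConnected ω
  unbounded : ¬ Bornology.IsBounded ω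
  periodic : ∀ (z : Fin d → ℤ) (x : Sp d), x + latticeVec z ∈ ω ↔ x ∈ ω
  inclusions : ∃ 𝓕 : Set (Set (Sp d)),
    (∀ D ∈ 𝓕, IsInclusion D) ∧
    (∃ c : ℝ, 0 < c ∧ ∀ D ∈ 𝓕, ∀ D' ∈ 𝓕, D ≠ D' → ∀ x ∈ D, ∀ y ∈ D', c ≤ dist x y) ∧
    ωᶜ = ⋃ D ∈ 𝓕, closure D

/-- The open set `F = ℝ^d ∖ closure ω`, which is the union of all the inclusions. -/
def inclusionSet {d : ℕ} (ω : Set (Sp d)) : Set (Sp d) := (closure ω)ᶜ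

open Classical in
/-- The contrast weight `Λ_s`, equal to `s` on `F` and to `1` elsewhere. -/
def contrast {d : ℕ} (ω : Set (Sp d)) (s : ℝ) (x : Sp d) : ℝ :=
  if x ∈ inclusionSet ω then s else 1

/-! ### Coefficients -/

/-- A tensor `a i j α β = a_{ij}^{αβ}`. -/
abbrev Tensor4 (d : ℕ) : Type := Fin d → Fin d → Fin d → Fin d → ℝ

/-- A `d × d` array `ξ i α = ξ_i^α`. A gradient is stored as `(∇u) i α = ∂_i u^α`. -/
abbrev Arr (d : ℕ) : Type := Fin d → Fin d → ℝ

/-- The squared Frobenius norm `|ξ|^2`. -/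
def normSq {d : ℕ} (ξ : Arr d) : ℝ := ∑ i, ∑ α, ξ i α ^ 2

/-- `a ξ · ζ = a_{ij}^{αβ} ξ_j^β ζ_i^α`, summed over all indices. -/
def pairing {d : ℕ} (a : Tensor4 d) (ξ ζ : Arr d) : ℝ :=
  ∑ i, ∑ j, ∑ α, ∑ β, a i j α β * ξ j β * ζ i α

/-- Real, bounded measurable, 1-periodic coefficients satisfying the elasticity condition with
constants `κ₁, κ₂`. -/
structure IsElasticity {d : ℕ} (κ₁ κ₂ : ℝ) (A : Sp d → Tensor4 d) : Prop where
  measurable : ∀ i j α β, Measurable fun x => A x i j α β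
  bounded : ∃ M : ℝ, ∀ x i j α β, |A x i j α β| ≤ M
  periodic : ∀ (z : Fin d → ℤ) (x : Sp d), A (x + latticeVec z) = A x
  symm_major : ∀ x i j α β, A x i j α β = A x j i β α
  symm_minor : ∀ x i j α β, A x i j α β = A x α j i β
  lower : ∀ x (ξ : Arr d), (∀ i α, ξ i α = ξ α i) → κ₁ * normSq ξ ≤ pairing (A x) ξ ξ
  upper : ∀ x (ξ : Arr d), (∀ i α, ξ i α = ξ α i) → pairing (A x) ξ ξ ≤ κ₂ * normSq ξ

/-! ### Sobolev functions and weak solutions -/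

/-- `φ ∈ C_c^∞(Ω; V)`. -/
structure IsTestFunction {d : ℕ} {V : Type*} [NormedAddCommGroup V] [NormedSpace ℝ V]
    (Ω : Set (Sp d)) (φ : Sp d → V) : Prop where
  smooth : ContDiff ℝ ((⊤ : ℕ∞) : WithTop ℕ∞) φ
  compact : HasCompactSupport φ
  support : tsupport φ ⊆ Ω

/-- The classical partial derivative `∂_i φ (x)`. -/
def partialDeriv {d : ℕ} {V : Type*} [NormedAddCommGroup V] [NormedSpace ℝ V]
    (i : Fin d) (φ : Sp d → V) (x : Sp d) : V :=
  fderiv ℝ φ x (EuclideanSpace.single i 1)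

/-- `u ∈ H^1(Ω; ℝ^d)` with weak gradient `G`, that is `G x i α = ∂_i u^α (x)`: both are
square integrable on `Ω` and integration by parts holds against all test functions. The weak
gradient is unique up to null sets of `Ω`. -/
structure IsH1 {d : ℕ} (Ω : Set (Sp d)) (u : Sp d → Sp d) (G : Sp d → Arr d) : Prop where
  memLp : MemLp u 2 (volume.restrict Ω)
  memLp_grad : ∀ i α, MemLp (fun x => G x i α) 2 (volume.restrict Ω)
  weak_grad : ∀ (φ : Sp d → ℝ), IsTestFunction Ω φ → ∀ i α,
    ∫ x in Ω, u x α * partialDeriv i φ x = - ∫ x in Ω, G x i α * φ x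

/-- `u ∈ H^1(Ω; ℝ^d)`, with weak gradient `G`, is a weak solution in `Ω` of
`- div (Λ_{δ^2} A ∇u) = 0`. Since the coefficients are bounded, testing with `C_c^∞(Ω; ℝ^d)` is the
same as testing with its `H^1`-closure `H^1_0(Ω; ℝ^d)`. -/
structure IsWeakSolution {d : ℕ} (ω : Set (Sp d)) (A : Sp d → Tensor4 d) (δ : ℝ)
    (Ω : Set (Sp d)) (u : Sp d → Sp d) (G : Sp d → Arr d) : Prop where
  isH1 : IsH1 Ω u G
  eq_zero : ∀ (v : Sp d → Sp d), IsTestFunction Ω v →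
    ∫ x in Ω, contrast ω (δ ^ 2) x * pairing (A x) (G x) (fun i α => partialDeriv i v x α) = 0

end HighContrast

end

/-! ### Geometry of the components of the complement of `ω` -/

namespace HighContrast

open Metric Set

variable {d : ℕ} {ω : Set (Sp d)}

/-! The only obstacle to a Caccioppoli inequality uniform in `δ` is the term carrying `∇η`, which on
the inclusions would be multiplied by `δ²`. It disappears if the cutoff `η` is constant near each
inclusion. The inclusions have uniformly bounded diameter and are uniformly separated, so at scales
`R ≥ R₀(ω)` such a cutoff exists and still satisfies `|∇η| ≤ C / R`
(`IsPeriodicMatrix.exists_cutoff`): precompose a ramp function with a map `s` that moves points a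
bounded distance and collapses a neighbourhood of each inclusion to a point
(`IsPeriodicMatrix.exists_collapse`), then mollify at a scale below the separation.

Testing the equation with `η² u` bounds the integral of `η² |sym ∇u|²` by that of `|∇η|² |u|²`: in
`ω` the weight is `1`, and on the inclusions the integrand is nonnegative and a weight `≥ 1` only
helps. Korn's first inequality for `η u` (`integral_normSq_le_symPart`) recovers the full gradient.
Together these give `IsWeakSolution.caccioppoli`.

Hence for `R ≥ R₀` the estimate holds without the gradient term on the right. For `R < R₀` that term
alone suffices, once `C ≥ R₀ ^ (2ℓ)`. -/

/-- The components of the complement of `ω` are bounded and uniformly separated. -/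
lemma IsPeriodicMatrix.exists_separation (hω : IsPeriodicMatrix ω) :
    ∃ c : ℝ, 0 < c ∧
      (∀ x ∈ ωᶜ, Bornology.IsBounded (connectedComponentIn ωᶜ x)) ∧
      ∀ x ∈ ωᶜ, ∀ y ∈ ωᶜ, dist x y < c →
        connectedComponentIn ωᶜ x = connectedComponentIn ωᶜ y := by
  obtain ⟨𝓕, hF, ⟨c, hc, hsep⟩, hun⟩ := hω.inclusions
  have hsep' : ∀ D ∈ 𝓕, ∀ D' ∈ 𝓕, D ≠ D' → ∀ x ∈ closure D, ∀ y ∈ closure D', c ≤ dist x y := by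
    intro D hD D' hD' hne x hx y hy
    by_contra! hlt
    obtain ⟨x', hx', hxx'⟩ := Metric.mem_closure_iff.1 hx ((c - dist x y) / 2) (by linarith)
    obtain ⟨y', hy', hyy'⟩ := Metric.mem_closure_iff.1 hy ((c - dist x y) / 2) (by linarith)
    have h1 := hsep D hD D' hD' hne x' hx' y' hy'
    have h2 := dist_triangle4_left x y x' y'
    linarith
  have hcover : ∀ x ∈ ωᶜ, ∃ D ∈ 𝓕, x ∈ closure D := by
    intro x hx
    rw [hun] at hx
    simpa using hx
  refine ⟨c, hc, ?_, ?_⟩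
  · intro x hx
    obtain ⟨D, hD, hxD⟩ := hcover x hx
    -- The two open sets cover `ωᶜ` and are disjoint, so a connected subset of `ωᶜ` meeting the
    -- first stays in it; this confines the component to a bounded set.
    have hdisj : Disjoint (thickening (c / 2) (closure D))
        (⋃ D' ∈ 𝓕 \ {D}, thickening (c / 2) (closure D')) := by
      rw [Set.disjoint_left]
      intro z hz hz'
      simp only [mem_iUnion] at hz'
      obtain ⟨D', hD', hz'⟩ := hz'
      obtain ⟨p, hp, hzp⟩ := mem_thickening_iff.1 hz
      obtain ⟨q, hq, hzq⟩ := mem_thickening_iff.1 hz'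
      have h1 := hsep' D hD D' hD'.1 (fun h => hD'.2 h.symm) p hp q hq
      have h2 := dist_triangle_left p q z
      linarith
    have hsub : connectedComponentIn ωᶜ x ⊆ thickening (c / 2) (closure D) := by
      refine isPreconnected_connectedComponentIn.subset_left_of_subset_union isOpen_thickening
        (isOpen_biUnion fun _ _ => isOpen_thickening) hdisj ?_
        ⟨x, mem_connectedComponentIn hx, self_subset_thickening (half_pos hc) _ hxD⟩
      intro y hy
      obtain ⟨D', hD', hyD'⟩ := hcover y (connectedComponentIn_subset _ _ hy)
      have hy' := self_subset_thickening (half_pos hc) _ hyD'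
      by_cases h : D' = D
      · exact Or.inl (h ▸ hy')
      · exact Or.inr (mem_biUnion (show D' ∈ 𝓕 \ {D} from ⟨hD', h⟩) hy')
    exact ((hF D hD).isBounded.closure.thickening).subset hsub
  · intro x hx y hy hxy
    obtain ⟨D, hD, hxD⟩ := hcover x hx
    obtain ⟨D', hD', hyD'⟩ := hcover y hy
    have hDD : D = D' := by
      by_contra hne
      exact absurd (hsep' D hD D' hD' hne x hxD y hyD') (not_le.2 hxy)
    subst hDD
    refine connectedComponentIn_eq ?_
    refine IsPreconnected.subset_connectedComponentIn
      (hF D hD).isConnected.isPreconnected.closure hxD ?_ hyD'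
    rw [hun]
    exact subset_biUnion_of_mem (u := fun D => closure D) hD

/-- The components of the complement of `ω` have uniformly bounded diameter. -/
lemma IsPeriodicMatrix.exists_diam_bound (hω : IsPeriodicMatrix ω) :
    ∃ M : ℝ, ∀ x ∈ ωᶜ, ∀ y ∈ connectedComponentIn ωᶜ x, dist y x ≤ M := by
  obtain ⟨c, hc, hbdd, heq⟩ := hω.exists_separation
  have hK : IsCompact {x : Sp d | ∀ i, x i ∈ Icc (0 : ℝ) 1} := by
    have h := (isCompact_univ_pi (fun _ : Fin d => isCompact_Icc (a := (0 : ℝ)) (b := 1)))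
    have h' := h.image (PiLp.continuous_toLp 2 (fun _ : Fin d => ℝ))
    convert h' using 1
    ext x
    constructor
    · intro hx
      exact ⟨fun i => x i, fun i _ => hx i, rfl⟩
    · rintro ⟨y, hy, rfl⟩ i
      exact hy i (mem_univ i)
  obtain ⟨M, hM⟩ : ∃ M : ℝ, ∀ x ∈ {x : Sp d | ∀ i, x i ∈ Icc (0 : ℝ) 1}, x ∈ ωᶜ →
      ∀ y ∈ connectedComponentIn ωᶜ x, dist y x ≤ M := by
    -- Points of `ωᶜ` closer than `c` share a component, so a bound holds locally; compactness of
    -- the closed unit cell makes it uniform there.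
    refine hK.induction_on (p := fun S : Set (Sp d) => ∃ M : ℝ, ∀ x ∈ S, x ∈ ωᶜ →
      ∀ y ∈ connectedComponentIn ωᶜ x, dist y x ≤ M) ⟨0, by simp⟩ ?_ ?_ ?_
    · rintro s t hst ⟨M, hM⟩
      exact ⟨M, fun x hx => hM x (hst hx)⟩
    · rintro s t ⟨M, hM⟩ ⟨N, hN⟩
      refine ⟨max M N, fun x hx hxω y hy => ?_⟩
      rcases hx with hx | hx
      · exact (hM x hx hxω y hy).trans (le_max_left _ _)
      · exact (hN x hx hxω y hy).trans (le_max_right _ _)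
    · intro p _
      by_cases hp : p ∈ ωᶜ
      · obtain ⟨M, hM⟩ := (isBounded_iff.1 (hbdd p hp))
        refine ⟨ball p c, mem_nhdsWithin_of_mem_nhds (ball_mem_nhds p hc), M, ?_⟩
        intro x hx hxω y hy
        have hE := heq x hxω p hp hx
        exact hM (hE ▸ hy) (hE ▸ mem_connectedComponentIn hxω)
      · refine ⟨ω, mem_nhdsWithin_of_mem_nhds (hω.isOpen.mem_nhds (not_not.1 hp)), 0, ?_⟩
        intro x hx hxω
        exact absurd hx hxω
  refine ⟨M, fun x hx y hy => ?_⟩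
  -- The lattice translation bringing `x` into the unit cell; it preserves `ωᶜ` and so permutes its
  -- components.
  set z : Fin d → ℤ := fun i => -⌊x i⌋
  have hper : ∀ y, y ∈ ωᶜ ↔ y + latticeVec z ∈ ωᶜ := fun y => not_congr (hω.periodic z y).symm
  have himg : (Homeomorph.addRight (latticeVec z)) '' ωᶜ = ωᶜ := by
    ext w
    constructor
    · rintro ⟨v, hv, rfl⟩
      exact (hper v).1 hv
    · intro hw
      refine ⟨w - latticeVec z, (hper _).2 (by simpa using hw), by simp⟩
  have hcomp := (Homeomorph.addRight (latticeVec z)).image_connectedComponentIn hx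
  rw [himg] at hcomp
  have hy' : y + latticeVec z ∈ connectedComponentIn ωᶜ (x + latticeVec z) := by
    have := mem_image_of_mem (Homeomorph.addRight (latticeVec z)) hy
    rw [hcomp] at this
    exact this
  have h := hM (x + latticeVec z) (fun i => ?_) ((hper x).1 hx) _ hy'
  · simpa using h
  · have : (x + latticeVec z) i = Int.fract (x i) := by
      simp [latticeVec, z, Int.fract, sub_eq_add_neg]
    rw [this]
    exact ⟨Int.fract_nonneg _, (Int.fract_lt_one _).le⟩

/-- A measurable map at bounded distance from the identity that collapses a neighbourhood of each
component of the complement of `ω` to a point. -/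
lemma IsPeriodicMatrix.exists_collapse (hω : IsPeriodicMatrix ω) :
    ∃ (r M : ℝ) (s : Sp d → Sp d), 0 < r ∧ 0 ≤ M ∧ Measurable s ∧ (∀ x, dist (s x) x ≤ M) ∧
      ∀ p ∈ ωᶜ, ∀ x ∈ ball p r, s x = s p := by
  classical
  obtain ⟨c, hc, -, heq⟩ := hω.exists_separation
  obtain ⟨M, hM⟩ := hω.exists_diam_bound
  -- The representative depends on the component as a set only, so equal components get the same
  -- point.
  let rep : Set (Sp d) → Sp d := fun S => Classical.epsilon fun x => x ∈ S
  have hrep : ∀ p ∈ ωᶜ, rep (connectedComponentIn ωᶜ p) ∈ connectedComponentIn ωᶜ p :=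
    fun p hp => Classical.epsilon_spec ⟨p, mem_connectedComponentIn hp⟩
  let s : Sp d → Sp d := fun x =>
    if h : ∃ p ∈ ωᶜ, dist x p < c / 2 then rep (connectedComponentIn ωᶜ h.choose) else x
  have hs : ∀ p ∈ ωᶜ, ∀ x ∈ ball p (c / 2), s x = rep (connectedComponentIn ωᶜ p) := by
    intro p hp x hx
    have h : ∃ p ∈ ωᶜ, dist x p < c / 2 := ⟨p, hp, hx⟩
    have hspec := h.choose_spec
    simp only [s, dif_pos h]
    congr 1
    -- Two points of `ωᶜ` within `c / 2` of `x` are less than `c` apart, so the value of `s` does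
    -- not depend on the chosen one.
    refine heq _ hspec.1 p hp ?_
    have := dist_triangle_left h.choose p x
    have hx' : dist x p < c / 2 := hx
    linarith [hspec.2]
  have hs' : ∀ x, (¬ ∃ p ∈ ωᶜ, dist x p < c / 2) → s x = x := fun x h => dif_neg h
  refine ⟨c / 2, max M 0 + c / 2, s, half_pos hc, by positivity, ?_, ?_, ?_⟩
  · have hpw : s = (thickening (c / 2) ωᶜ).piecewise s id := by
      ext1 x
      by_cases hx : x ∈ thickening (c / 2) ωᶜ
      · simp [hx]
      · rw [Set.piecewise_eq_of_notMem _ _ _ hx]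
        exact hs' x (fun h => hx (mem_thickening_iff.2 h))
    rw [hpw]
    refine ContinuousOn.measurable_piecewise ?_ continuousOn_id isOpen_thickening.measurableSet
    intro x hx
    obtain ⟨p, hp, hxp⟩ := mem_thickening_iff.1 hx
    refine ContinuousAt.continuousWithinAt ?_
    refine (continuousAt_const (y := rep (connectedComponentIn ωᶜ p))).congr ?_
    filter_upwards [isOpen_ball.mem_nhds hxp] with y hy
    exact (hs p hp y hy).symm
  · intro x
    by_cases h : ∃ p ∈ ωᶜ, dist x p < c / 2
    · obtain ⟨p, hp, hxp⟩ := h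
      rw [hs p hp x hxp]
      have h1 := dist_triangle (rep (connectedComponentIn ωᶜ p)) p x
      have h2 := hM p hp _ (hrep p hp)
      rw [dist_comm] at hxp
      linarith [le_max_left M 0]
    · rw [hs' x h, dist_self]
      positivity
  · intro p hp x hx
    rw [hs p hp x hx, hs p hp p (mem_ball_self (half_pos hc))]

end HighContrast

/-! ### Cutoffs that are locally constant on the inclusions -/

namespace HighContrast

open Metric Set
open scoped Convolution

variable {d : ℕ} {ω : Set (Sp d)}

/-- The piecewise linear cutoff in the sup norm, between the cubes of sides `5R/8` and `7R/8`. -/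
noncomputable def rampCutoff (R : ℝ) (x : Sp d) : ℝ := max 0 (min 1 (7 / 2 - 8 / R * ‖x.ofLp‖))

lemma rampCutoff_nonneg (R : ℝ) (x : Sp d) : 0 ≤ rampCutoff R x := le_max_left _ _

lemma rampCutoff_le_one (R : ℝ) (x : Sp d) : rampCutoff R x ≤ 1 :=
  max_le zero_le_one (min_le_left _ _)

lemma continuous_rampCutoff (R : ℝ) : Continuous (rampCutoff (d := d) R) := by
  unfold rampCutoff
  have : Continuous fun x : Sp d => ‖x.ofLp‖ := (PiLp.continuous_ofLp 2 _).norm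
  fun_prop

lemma abs_norm_ofLp_sub_le (x y : Sp d) : |‖x.ofLp‖ - ‖y.ofLp‖| ≤ dist x y := by
  refine (abs_norm_sub_norm_le _ _).trans ?_
  rw [dist_eq_norm, ← WithLp.ofLp_sub]
  refine (pi_norm_le_iff_of_nonneg (norm_nonneg _)).2 fun i => ?_
  exact PiLp.norm_apply_le (x - y) i

lemma abs_rampCutoff_sub_le {R : ℝ} (hR : 0 < R) (x y : Sp d) :
    |rampCutoff R x - rampCutoff R y| ≤ 8 / R * dist x y := by
  have h := abs_norm_ofLp_sub_le x y
  have h1 : |rampCutoff R x - rampCutoff R y| ≤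
      |(7 / 2 - 8 / R * ‖x.ofLp‖) - (7 / 2 - 8 / R * ‖y.ofLp‖)| := by
    unfold rampCutoff
    have h2 := abs_max_sub_max_le_max 0 (min 1 (7 / 2 - 8 / R * ‖x.ofLp‖)) 0
      (min 1 (7 / 2 - 8 / R * ‖y.ofLp‖))
    have h3 := abs_min_sub_min_le_max 1 (7 / 2 - 8 / R * ‖x.ofLp‖) 1 (7 / 2 - 8 / R * ‖y.ofLp‖)
    simp only [sub_self, abs_zero, abs_nonneg, max_eq_right] at h2 h3
    exact h2.trans h3
  refine h1.trans ?_
  rw [show (7 / 2 - 8 / R * ‖x.ofLp‖) - (7 / 2 - 8 / R * ‖y.ofLp‖)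
    = -(8 / R * (‖x.ofLp‖ - ‖y.ofLp‖)) by ring, abs_neg, abs_mul, abs_of_pos (by positivity)]
  gcongr

lemma rampCutoff_eq_one {R : ℝ} (hR : 0 < R) {x : Sp d} (hx : ‖x.ofLp‖ ≤ 5 / 16 * R) :
    rampCutoff R x = 1 := by
  have : 8 / R * ‖x.ofLp‖ ≤ 5 / 2 := by
    calc 8 / R * ‖x.ofLp‖ ≤ 8 / R * (5 / 16 * R) := by gcongr
      _ = 5 / 2 := by field_simp; norm_num
  rw [rampCutoff, min_eq_left (by linarith), max_eq_right zero_le_one]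

lemma rampCutoff_eq_zero {R : ℝ} (hR : 0 < R) {x : Sp d} (hx : 7 / 16 * R ≤ ‖x.ofLp‖) :
    rampCutoff R x = 0 := by
  have : 7 / 2 ≤ 8 / R * ‖x.ofLp‖ := by
    calc 7 / 2 = 8 / R * (7 / 16 * R) := by field_simp; norm_num
      _ ≤ _ := by gcongr
  rw [rampCutoff, max_eq_left]
  exact (min_le_right _ _).trans (by linarith)

lemma isOpen_cube (d : ℕ) (R : ℝ) : IsOpen (cube d R) := by
  have : cube d R = ⋂ i, (fun x : Sp d => x i) ⁻¹' Ioo (-(R / 2)) (R / 2) := by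
    ext x; simp [cube]
  rw [this]
  exact isOpen_iInter_of_finite fun i =>
    isOpen_Ioo.preimage (EuclideanSpace.proj (𝕜 := ℝ) i).continuous

lemma norm_ofLp_le_of_mem_cube {R : ℝ} (hR : 0 ≤ R) {x : Sp d} (hx : x ∈ cube d R) :
    ‖x.ofLp‖ ≤ R / 2 :=
  (pi_norm_le_iff_of_nonneg (by positivity)).2 fun i => abs_le.2 ⟨(hx i).1.le, (hx i).2.le⟩

lemma mem_cube_of_norm_ofLp_lt {R : ℝ} {x : Sp d} (hx : ‖x.ofLp‖ < R / 2) : x ∈ cube d R :=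
  fun i => abs_lt.1 ((norm_le_pi_norm x.ofLp i).trans_lt hx)

set_option maxSynthPendingDepth 3 in
/-- The gradient of a mollification is controlled by the size of the function nearby. -/
lemma exists_fderiv_convolution_bound {E : Type*} [NormedAddCommGroup E] [NormedSpace ℝ E]
    [FiniteDimensional ℝ E] [MeasurableSpace E] [BorelSpace E] (μ : Measure E)
    [μ.IsAddHaarMeasure] {ρ : E → ℝ} (hρc : HasCompactSupport ρ) (hρs : ContDiff ℝ 1 ρ) {r : ℝ}
    (hr : tsupport ρ ⊆ ball 0 r) :
    ∃ I : ℝ, 0 ≤ I ∧ ∀ (f : E → ℝ) (x : E) (ε : ℝ), LocallyIntegrable f μ → 0 ≤ ε →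
      (∀ y ∈ ball x r, ‖f y‖ ≤ ε) →
      ‖fderiv ℝ (ρ ⋆[ContinuousLinearMap.lsmul ℝ ℝ, μ] f) x‖ ≤ I * ε := by
  refine ⟨‖(ContinuousLinearMap.lsmul ℝ ℝ : ℝ →L[ℝ] ℝ →L[ℝ] ℝ).precompL E‖ *
    ∫ x, ‖fderiv ℝ ρ x‖ ∂μ, by positivity, fun f x ε hf hε hfx => ?_⟩
  rw [(hρc.hasFDerivAt_convolution_left (ContinuousLinearMap.lsmul ℝ ℝ) hρs hf x).fderiv]
  have hbd := dist_convolution_le' (μ := μ)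
    (L := (ContinuousLinearMap.lsmul ℝ ℝ : ℝ →L[ℝ] ℝ →L[ℝ] ℝ).precompL E)
    (f := fderiv ℝ ρ) (g := f) (x₀ := x) (R := r) (z₀ := 0) (ε := ε) hε
    ((hρs.continuous_fderiv one_ne_zero).integrable_of_hasCompactSupport (hρc.fderiv ℝ))
    ((support_fderiv_subset ℝ).trans hr) hf.aestronglyMeasurable
    (fun y hy => by simpa using hfx y hy)
  simpa only [map_zero, integral_zero, dist_zero_right] using hbd

/-- Cutoff functions between cubes of comparable sides which are locally constant on the
complement of `ω`. -/
lemma IsPeriodicMatrix.exists_cutoff (hω : IsPeriodicMatrix ω) :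
    ∃ R₀ C : ℝ, 0 < R₀ ∧ 0 < C ∧ ∀ R, R₀ ≤ R → ∃ η : Sp d → ℝ, IsTestFunction (cube d R) η ∧
      (∀ x ∈ cube d (R / 2), η x = 1) ∧ (∀ x, ‖fderiv ℝ η x‖ ≤ C / R) ∧
      ∀ x ∈ ωᶜ, fderiv ℝ η x = 0 := by
  obtain ⟨r, M, s, hr, hM, hsm, hsd, hsc⟩ := hω.exists_collapse
  -- With outer radius `r / 2`, the values of the mollification on `ball p (r / 2)` only involve
  -- `ball p r`, where `s` is constant if `p ∈ ωᶜ`.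
  let b : ContDiffBump (0 : Sp d) := ⟨r / 4, r / 2, by linarith, by linarith⟩
  set ρ : Sp d → ℝ := b.normed volume with hρdef
  have hρc : HasCompactSupport ρ := b.hasCompactSupport_normed
  have hρs : ContDiff ℝ ((⊤ : ℕ∞) : WithTop ℕ∞) ρ := b.contDiff_normed
  have hρs1 : ContDiff ℝ 1 ρ := b.contDiff_normed
  have hρr : tsupport ρ ⊆ ball 0 r := by
    rw [hρdef, b.tsupport_normed_eq]
    exact closedBall_subset_ball (by change r / 2 < r; linarith)
  obtain ⟨I, hI0, hI⟩ := exists_fderiv_convolution_bound volume hρc hρs1 hρr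
  -- Collapsing and mollifying shift positions by at most `M + r / 2 ≤ R / 32`, which fits between
  -- the ramp's sup-norm radii `5R/16`, `7R/16` and the required `R/4`, `R/2`. In the second
  -- constant, `8 / R` is the slope of the ramp and `2M + r` bounds `dist (s y) (s x)` for `y ∈ ball
  -- x r`; `I + 1` ensures positivity.
  refine ⟨32 * (M + r), (I + 1) * (8 * (2 * M + r)), by positivity, by positivity, fun R hR => ?_⟩
  have hR0 : 0 < R := lt_of_lt_of_le (by positivity) hR
  set h : Sp d → ℝ := fun x => rampCutoff R (s x) with hh
  have hhm : Measurable h := (continuous_rampCutoff R).measurable.comp hsm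
  have hh1 : ∀ x, ‖h x‖ ≤ 1 := fun x => by
    rw [Real.norm_eq_abs, abs_of_nonneg (rampCutoff_nonneg _ _)]
    exact rampCutoff_le_one _ _
  have hloc : ∀ a : ℝ, LocallyIntegrable (fun x => h x - a) volume := by
    intro a
    refine LocallyIntegrable.sub ?_ (locallyIntegrable_const a)
    exact (locallyIntegrable_const (1 : ℝ)).mono hhm.aestronglyMeasurable
      (Filter.Eventually.of_forall fun x => by simpa using hh1 x)
  have hloc0 : LocallyIntegrable h volume := by simpa using hloc 0
  let conv : (Sp d → ℝ) → Sp d → ℝ := fun f => ρ ⋆[ContinuousLinearMap.lsmul ℝ ℝ, volume] f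
  set η : Sp d → ℝ := conv h with hη
  have hη_const : ∀ (x : Sp d) (a : ℝ), (∀ y ∈ ball x (r / 2), h y = a) → η x = a := by
    intro x a hx
    have hxa : h x = a := hx x (mem_ball_self (half_pos hr))
    rw [← hxa]
    exact b.normed_convolution_eq_right (fun y hy => (hx y hy).trans hxa.symm)
  have hnear : ∀ x y, y ∈ ball x (r / 2) → |‖(s y).ofLp‖ - ‖x.ofLp‖| ≤ M + r / 2 := by
    intro x y hy
    have h1 := abs_norm_ofLp_sub_le (s y) x
    have h2 := dist_triangle (s y) y x
    have h3 := hsd y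
    have h4 : dist y x < r / 2 := hy
    linarith
  have hsupp : Function.support η ⊆ {x | ‖x.ofLp‖ ≤ 15 / 32 * R} := by
    intro x hx
    by_contra hx'
    simp only [mem_ofPred_eq, not_le] at hx'
    refine hx (hη_const x 0 fun y hy => rampCutoff_eq_zero hR0 ?_)
    have := (abs_le.1 (hnear x y hy)).1
    linarith
  have hclosed : IsClosed {x : Sp d | ‖x.ofLp‖ ≤ 15 / 32 * R} :=
    isClosed_le (PiLp.continuous_ofLp 2 _).norm continuous_const
  have htsupp : tsupport η ⊆ {x | ‖x.ofLp‖ ≤ 15 / 32 * R} := closure_minimal hsupp hclosed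
  have hcpt : IsCompact {x : Sp d | ‖x.ofLp‖ ≤ 15 / 32 * R} := by
    have h1 := (isCompact_closedBall (0 : Fin d → ℝ) (15 / 32 * R)).image
      (PiLp.continuous_toLp 2 (fun _ : Fin d => ℝ))
    convert h1 using 1
    ext x
    constructor
    · intro hx
      exact ⟨x.ofLp, by simpa using hx, rfl⟩
    · rintro ⟨y, hy, rfl⟩
      simpa using hy
  refine ⟨η, ⟨?_, ?_, ?_⟩, ?_, ?_, ?_⟩
  · exact hρc.contDiff_convolution_left _ hρs hloc0
  · exact hcpt.of_isClosed_subset (isClosed_tsupport η) htsupp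
  · intro x hx
    refine mem_cube_of_norm_ofLp_lt ?_
    have : ‖x.ofLp‖ ≤ 15 / 32 * R := htsupp hx
    linarith
  · intro x hx
    refine hη_const x 1 fun y hy => rampCutoff_eq_one hR0 ?_
    have h1 := (abs_le.1 (hnear x y hy)).2
    have h2 := norm_ofLp_le_of_mem_cube (by positivity) hx
    linarith
  · intro x
    -- Mollification preserves constants, so `∇η` at `x` sees only the oscillation of `h` near `x`,
    -- which is of order `1 / R`.
    have hsplit : η = fun y => conv (fun t => h t - h x) y + h x := by
      ext y
      have hex1 : ConvolutionExistsAt ρ (fun t => h t - h x) y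
          (ContinuousLinearMap.lsmul ℝ ℝ) volume :=
        hρc.convolutionExists_left _ hρs.continuous (hloc (h x)) y
      have hex2 : ConvolutionExistsAt ρ (fun _ => h x) y
          (ContinuousLinearMap.lsmul ℝ ℝ) volume :=
        hρc.convolutionExists_left _ hρs.continuous (locallyIntegrable_const _) y
      have hadd := hex1.distrib_add hex2
      have hc : conv (fun _ => h x) y = h x := b.normed_convolution_eq_right fun _ _ => rfl
      calc η y = conv ((fun t => h t - h x) + fun _ => h x) y := by
            simp only [hη]
            congr 1
            ext t
            simp
        _ = conv (fun t => h t - h x) y + conv (fun _ => h x) y := hadd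
        _ = _ := by rw [hc]
    have hbd := hI (fun t => h t - h x) x (8 / R * (2 * M + r)) (hloc (h x)) (by positivity) ?_
    · rw [hsplit, fderiv_add_const]
      refine hbd.trans ?_
      rw [show (I + 1) * (8 * (2 * M + r)) / R = (I + 1) * (8 / R * (2 * M + r)) by ring]
      gcongr
      linarith
    · intro y hy
      rw [Real.norm_eq_abs]
      refine (abs_rampCutoff_sub_le hR0 _ _).trans ?_
      gcongr
      have h1 := dist_triangle4 (s y) y x (s x)
      have h2 := hsd y
      have h3 := hsd x
      rw [dist_comm] at h3
      have h4 : dist y x < r := hy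
      linarith
  · intro p hp
    have : η =ᶠ[nhds p] fun _ => h p := by
      filter_upwards [ball_mem_nhds p (half_pos hr)] with x hx
      refine hη_const x (h p) fun y hy => ?_
      simp only [hh]
      rw [hsc p hp y]
      have h1 : dist y x < r / 2 := hy
      have h2 : dist x p < r / 2 := hx
      have h3 := dist_triangle y x p
      rw [mem_ball]
      linarith
    rw [this.fderiv_eq]
    simp

end HighContrast

/-! ### Testing with Sobolev functions by mollification -/

namespace HighContrast

open Metric Set
open scoped Convolution

variable {d : ℕ}

/-- `w ∈ H^1(ℝ^d)` with weak gradient `W`. -/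
structure IsWeakGrad (w : Sp d → ℝ) (W : Fin d → Sp d → ℝ) : Prop where
  memLp : MemLp w 2 volume
  memLp_grad : ∀ i, MemLp (W i) 2 volume
  weak_grad : ∀ φ : Sp d → ℝ, IsTestFunction univ φ → ∀ i,
    ∫ x, w x * partialDeriv i φ x = - ∫ x, W i x * φ x

section Correlation

variable {f g : Sp d → ℝ}

/-- The correlation of two square integrable functions is continuous. -/
lemma continuous_integral_mul_add (hf : MemLp f 2 volume) (hg : MemLp g 2 volume) :
    Continuous fun t : Sp d => ∫ x, f x * g (t + x) := by
  have hfact : Fact ((2 : ENNReal) ≠ ⊤) := ⟨by simp⟩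
  -- As an `L²` inner product with a translate, the correlation inherits continuity from that of
  -- translations in `L²`.
  have h : (fun t : Sp d => ∫ x, f x * g (t + x)) =
      fun t => inner ℝ (hf.toLp f) (DomAddAct.mk t +ᵥ hg.toLp g) := by
    ext t
    rw [DomAddAct.mk_vadd_toLp, L2.inner_def]
    refine integral_congr_ae ?_
    filter_upwards [hf.coeFn_toLp, (hg.comp_measurePreserving
      (measurePreserving_vadd t volume)).coeFn_toLp] with x h1 h2
    rw [h1]
    refine Eq.trans ?_ (congrArg (fun z => inner ℝ (f x) z) h2).symm
    simp [mul_comm]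
  rw [h]
  refine continuous_const.inner ?_
  exact (DomAddAct.continuous_mk).vadd continuous_const

/-- Fubini; the integrand on the product space is dominated through `|f g| ≤ f² + g²`, which leaves
two integrable products of an `L¹` function with `|ρ|`. -/
lemma integral_mul_convolution {ρ : Sp d → ℝ} (hρ : Integrable ρ volume)
    (hf : MemLp f 2 volume) (hg : MemLp g 2 volume) :
    ∫ x, f x * ∫ t, ρ t * g (x - t) = ∫ t, ρ t * ∫ x, f x * g (x - t) := by
  have hint : Integrable (fun p : Sp d × Sp d => f p.1 * (ρ p.2 * g (p.1 - p.2)))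
      (volume.prod volume) := by
    have h1 : Integrable (fun p : Sp d × Sp d => f p.1 ^ 2 * |ρ p.2|) (volume.prod volume) :=
      hf.integrable_sq.mul_prod hρ.abs
    have h2 : Integrable (fun p : Sp d × Sp d => |ρ p.2| * g (p.1 - p.2) ^ 2)
        (volume.prod volume) :=
      hρ.abs.convolution_integrand (ContinuousLinearMap.mul ℝ ℝ) hg.integrable_sq
    refine (h1.add h2).mono' ?_ (Filter.Eventually.of_forall fun p => ?_)
    · exact hf.1.comp_fst.mul (hρ.1.convolution_integrand (ContinuousLinearMap.mul ℝ ℝ) hg.1)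
    · simp only [Pi.add_apply, Real.norm_eq_abs, abs_mul]
      have h3 := abs_nonneg (ρ p.2)
      have h4 : |f p.1| * |g (p.1 - p.2)| ≤ f p.1 ^ 2 + g (p.1 - p.2) ^ 2 := by
        rw [← sq_abs (f p.1), ← sq_abs (g (p.1 - p.2))]
        nlinarith [sq_nonneg (|f p.1| - |g (p.1 - p.2)|), sq_nonneg (f p.1),
          sq_nonneg (g (p.1 - p.2)), sq_abs (f p.1), sq_abs (g (p.1 - p.2))]
      nlinarith
  calc ∫ x, f x * ∫ t, ρ t * g (x - t)
      = ∫ x, ∫ t, f x * (ρ t * g (x - t)) := by simp_rw [integral_const_mul]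
    _ = ∫ t, ∫ x, f x * (ρ t * g (x - t)) := integral_integral_swap hint
    _ = ∫ t, ρ t * ∫ x, f x * g (x - t) := by
      simp_rw [← integral_const_mul]
      congr! 4
      ring

end Correlation

/-- The partial derivatives of a mollified Sobolev function are the mollified weak derivatives. -/
lemma IsWeakGrad.partialDeriv_convolution {w : Sp d → ℝ} {W : Fin d → Sp d → ℝ}
    (hw : IsWeakGrad w W) {ρ : Sp d → ℝ} (hρ : IsTestFunction univ ρ) (i : Fin d) (x : Sp d) :
    partialDeriv i (w ⋆[ContinuousLinearMap.lsmul ℝ ℝ, volume] ρ) x =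
      ∫ t, ρ t * W i (x - t) := by
  have hloc : LocallyIntegrable w volume := hw.memLp.locallyIntegrable (by norm_num)
  have hρ1 : ContDiff ℝ 1 ρ := hρ.smooth.of_le (by exact_mod_cast le_top)
  have hφ : IsTestFunction univ fun t => ρ (x - t) := by
    refine ⟨hρ.smooth.comp (contDiff_const.sub contDiff_id), ?_, subset_univ _⟩
    exact hρ.compact.comp_homeomorph (Homeomorph.subLeft x)
  have hder : ∀ t, partialDeriv i (fun t => ρ (x - t)) t =
      -(fderiv ℝ ρ (x - t) (EuclideanSpace.single i 1)) := by
    intro t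
    have h1 : HasFDerivAt (fun t => ρ (x - t)) _ t :=
      (hρ1.differentiable one_ne_zero (x - t)).hasFDerivAt.comp t
        ((hasFDerivAt_id t).const_sub x)
    rw [partialDeriv, h1.fderiv]
    simp
  have h := hw.weak_grad _ hφ i
  rw [partialDeriv, (hρ.compact.hasFDerivAt_convolution_right (ContinuousLinearMap.lsmul ℝ ℝ)
    hloc hρ1 x).fderiv,
    convolution_precompR_apply _ hloc (hρ.compact.fderiv ℝ) (hρ1.continuous_fderiv one_ne_zero),
    convolution_lsmul]
  simp only [hder, mul_neg, integral_neg, neg_inj] at h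
  simp only [smul_eq_mul, h]
  rw [← integral_sub_left_eq_self (fun t => ρ t * W i (x - t)) volume x]
  simp [mul_comm]

/-- A field orthogonal to the gradients of test functions in `Ω` is orthogonal to the weak
gradients of Sobolev functions with compact support in `Ω`. -/
theorem IsWeakGrad.integral_eq_zero {w : Sp d → ℝ} {W : Fin d → Sp d → ℝ}
    (hw : IsWeakGrad w W) {Ω K : Set (Sp d)} (hΩ : IsOpen Ω) (hK : IsCompact K) (hKΩ : K ⊆ Ω)
    (hwK : Function.support w ⊆ K) {B : Fin d → Sp d → ℝ} (hB : ∀ i, MemLp (B i) 2 volume)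
    (horth : ∀ v : Sp d → ℝ, IsTestFunction Ω v → ∑ i, ∫ x, B i x * partialDeriv i v x = 0) :
    ∑ i, ∫ x, B i x * W i x = 0 := by
  -- The target is `c 0`. Mollifying `c` at `0` amounts to pairing `B` with the gradient of the
  -- mollified `w`, a test function in `Ω` at small scales, and so gives `0`. Continuity of `c` then
  -- replaces `L²` convergence of mollified gradients.
  set c : Sp d → ℝ := fun t => ∑ i, ∫ x, B i x * W i (t + x) with hc
  have hcc : Continuous c :=
    continuous_finsetSum _ fun i _ => continuous_integral_mul_add (hB i) (hw.memLp_grad i)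
  have hc0 : c 0 = ∑ i, ∫ x, B i x * W i x := by simp [hc]
  rw [← hc0]
  obtain ⟨r₁, hr₁, hr₁Ω⟩ := hK.exists_cthickening_subset_open hΩ hKΩ
  refine eq_of_forall_dist_le fun ε hε => ?_
  obtain ⟨r₂, hr₂, hr₂c⟩ := Metric.continuous_iff.1 hcc 0 ε hε
  have hr : 0 < min r₁ r₂ := lt_min hr₁ hr₂
  let b : ContDiffBump (0 : Sp d) :=
    ⟨min r₁ r₂ / 2, min r₁ r₂, half_pos hr, half_lt_self hr⟩
  have hρ : IsTestFunction univ (b.normed volume) :=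
    ⟨b.contDiff_normed, b.hasCompactSupport_normed, subset_univ _⟩
  have hloc : LocallyIntegrable w volume := hw.memLp.locallyIntegrable (by norm_num)
  set v := w ⋆[ContinuousLinearMap.lsmul ℝ ℝ, volume] b.normed volume with hv
  have hvsupp : tsupport v ⊆ cthickening r₁ K := by
    refine closure_minimal ?_ isClosed_cthickening
    refine (support_convolution_subset_swap _).trans ?_
    rintro _ ⟨y, hy, z, hz, rfl⟩
    rw [b.support_normed_eq] at hy
    refine mem_cthickening_of_dist_le _ z _ _ (hwK hz) ?_
    have hy' : dist y 0 < min r₁ r₂ := hy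
    simpa using hy'.le.trans (min_le_left _ _)
  have hvt : IsTestFunction Ω v :=
    ⟨hρ.compact.contDiff_convolution_right _ hloc hρ.smooth,
      hK.cthickening.of_isClosed_subset (isClosed_tsupport _) hvsupp, hvsupp.trans hr₁Ω⟩
  have hconv : (b.normed volume ⋆[ContinuousLinearMap.lsmul ℝ ℝ, volume] c) 0 = 0 := by
    have hci : ∀ i, Continuous fun t : Sp d => ∫ x, B i x * W i (t + x) := fun i =>
      continuous_integral_mul_add (hB i) (hw.memLp_grad i)
    rw [← horth v hvt, convolution_lsmul]
    simp only [hv, hw.partialDeriv_convolution hρ,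
      fun i => integral_mul_convolution b.integrable_normed (hB i) (hw.memLp_grad i)]
    rw [← integral_finsetSum]
    · congr 1
      ext t
      simp only [hc, smul_eq_mul, Finset.mul_sum, zero_sub, neg_add_eq_sub]
    · intro i _
      have : Continuous fun t : Sp d => b.normed volume t * ∫ x, B i x * W i (x - t) := by
        refine b.continuous_normed.mul ?_
        simpa only [Function.comp_def, sub_eq_neg_add] using (hci i).comp continuous_neg
      exact this.integrable_of_hasCompactSupport hρ.compact.mul_right
  have hd := b.dist_normed_convolution_le (μ := volume) (x₀ := 0) (ε := ε)
    hcc.aestronglyMeasurable fun x hx =>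
      (hr₂c x (lt_of_lt_of_le (show dist x 0 < min r₁ r₂ from hx) (min_le_right _ _))).le
  rwa [hconv, dist_comm] at hd

end HighContrast

/-! ### Localised Sobolev functions and Korn's inequality -/

namespace HighContrast

open Metric Set

variable {d : ℕ}

lemma memLp_mul_of_bound {μ : Measure (Sp d)} {f g : Sp d → ℝ} (hf : AEStronglyMeasurable f μ)
    {C : ℝ} (hC : ∀ x, |f x| ≤ C) (hg : MemLp g 2 μ) : MemLp (fun x => f x * g x) 2 μ :=
  hg.mul (memLp_top_of_bound hf C (Filter.Eventually.of_forall hC))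

lemma integrable_mul_of_memLp {μ : Measure (Sp d)} {f g : Sp d → ℝ} (hf : MemLp f 2 μ)
    (hg : MemLp g 2 μ) : Integrable (fun x => f x * g x) μ :=
  hf.integrable_mul hg

namespace IsTestFunction

variable {Ω : Set (Sp d)} {η φ : Sp d → ℝ}

lemma memLp (hφ : IsTestFunction Ω φ) (μ : Measure (Sp d)) [IsFiniteMeasureOnCompacts μ] :
    MemLp φ 2 μ :=
  hφ.smooth.continuous.memLp_of_hasCompactSupport hφ.compact

lemma exists_bound (hφ : IsTestFunction Ω φ) : ∃ C, ∀ x, |φ x| ≤ C :=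
  hφ.compact.exists_bound_of_continuous hφ.smooth.continuous

lemma differentiable (hφ : IsTestFunction Ω φ) : Differentiable ℝ φ :=
  hφ.smooth.differentiable (by simp)

lemma mul (hη : IsTestFunction Ω η) (hφ : ContDiff ℝ ((⊤ : ℕ∞) : WithTop ℕ∞) φ) :
    IsTestFunction Ω fun x => η x * φ x :=
  ⟨hη.smooth.mul hφ, hη.compact.mul_right, (tsupport_mul_subset_left).trans hη.support⟩

lemma partialDeriv (hφ : IsTestFunction Ω φ) (i : Fin d) :
    IsTestFunction Ω (partialDeriv i φ) :=
  ⟨(hφ.smooth.fderiv_right (m := ((⊤ : ℕ∞) : WithTop ℕ∞)) (by simp)).clm_apply contDiff_const,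
    hφ.compact.fderiv_apply ℝ _, (tsupport_fderiv_apply_subset ℝ _).trans hφ.support⟩

lemma eq_zero_of_notMem (hφ : IsTestFunction Ω φ) {x : Sp d} (hx : x ∉ Ω) : φ x = 0 :=
  image_eq_zero_of_notMem_tsupport fun h => hx (hφ.support h)

end IsTestFunction

lemma partialDeriv_mul {η φ : Sp d → ℝ} {x : Sp d} (hη : DifferentiableAt ℝ η x)
    (hφ : DifferentiableAt ℝ φ x) (i : Fin d) :
    partialDeriv i (fun x => η x * φ x) x =
      η x * partialDeriv i φ x + partialDeriv i η x * φ x := by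
  simp only [partialDeriv, fderiv_fun_mul hη hφ]
  simp [mul_comm]

lemma partialDeriv_comm {φ : Sp d → ℝ} (hφ : ContDiff ℝ ((⊤ : ℕ∞) : WithTop ℕ∞) φ)
    (i j : Fin d) (x : Sp d) :
    partialDeriv i (partialDeriv j φ) x = partialDeriv j (partialDeriv i φ) x := by
  have hd : DifferentiableAt ℝ (fderiv ℝ φ) x :=
    ((hφ.fderiv_right (m := ((⊤ : ℕ∞) : WithTop ℕ∞)) (by simp)).differentiable (by simp)) x
  have h : ∀ k l : Fin d, partialDeriv k (partialDeriv l φ) x =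
      fderiv ℝ (fderiv ℝ φ) x (EuclideanSpace.single k 1) (EuclideanSpace.single l 1) := by
    intro k l
    have : partialDeriv l φ = fun y => fderiv ℝ φ y (EuclideanSpace.single l 1) := rfl
    rw [this, partialDeriv, fderiv_clm_apply hd (differentiableAt_const _)]
    simp
  rw [h, h]
  exact (hφ.contDiffAt.isSymmSndFDerivAt (by
    rw [minSmoothness_of_isRCLikeNormedField]
    exact WithTop.coe_le_coe.2 le_top)) _ _

/-- The product of a Sobolev function on `Ω` with a test function, extended by zero. -/
lemma IsH1.isWeakGrad_mul {Ω : Set (Sp d)} (hΩ : MeasurableSet Ω) {u : Sp d → Sp d}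
    {G : Sp d → Arr d} (hu : IsH1 Ω u G) {η : Sp d → ℝ} (hη : IsTestFunction Ω η) (α : Fin d) :
    IsWeakGrad (fun x => η x * u x α)
      (fun i x => η x * G x i α + partialDeriv i η x * u x α) := by
  have huα : MemLp (fun x => u x α) 2 (volume.restrict Ω) :=
    (EuclideanSpace.proj (𝕜 := ℝ) α).comp_memLp' hu.memLp
  have hmul : ∀ (φ : Sp d → ℝ) (f : Sp d → ℝ), IsTestFunction Ω φ →
      MemLp f 2 (volume.restrict Ω) → MemLp (fun x => φ x * f x) 2 volume := by
    intro φ f hφ hf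
    obtain ⟨C, hC⟩ := hφ.exists_bound
    have h := (memLp_indicator_iff_restrict hΩ).2
      (memLp_mul_of_bound hφ.smooth.continuous.aestronglyMeasurable hC hf)
    have heq : (fun x => φ x * f x) = Ω.indicator fun x => φ x * f x := by
      ext x
      by_cases hx : x ∈ Ω
      · simp [hx]
      · simp [hx, hφ.eq_zero_of_notMem hx]
    rw [heq]
    exact h
  refine ⟨hmul _ _ hη huα, fun i => (hmul _ _ hη (hu.memLp_grad i α)).add
    (hmul _ _ (hη.partialDeriv i) huα), fun φ hφ i => ?_⟩
  have hηφ := hη.mul hφ.smooth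
  have h := hu.weak_grad _ hηφ i α
  rw [setIntegral_eq_integral_of_forall_compl_eq_zero,
    setIntegral_eq_integral_of_forall_compl_eq_zero] at h
  · have hd : ∀ x, partialDeriv i (fun x => η x * φ x) x =
        η x * partialDeriv i φ x + partialDeriv i η x * φ x := fun x =>
      partialDeriv_mul (hη.differentiable x) (hφ.differentiable x) i
    have i1 : Integrable (fun x => (η x * u x α) * partialDeriv i φ x) volume :=
      (hmul _ _ hη huα).integrable_mul ((hφ.partialDeriv i).memLp volume)
    have i2 : Integrable (fun x => (partialDeriv i η x * u x α) * φ x) volume :=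
      (hmul _ _ (hη.partialDeriv i) huα).integrable_mul (hφ.memLp volume)
    have i3 : Integrable (fun x => (η x * G x i α) * φ x) volume :=
      (hmul _ _ hη (hu.memLp_grad i α)).integrable_mul (hφ.memLp volume)
    have e1 : ∫ x, u x α * partialDeriv i (fun x => η x * φ x) x =
        (∫ x, (η x * u x α) * partialDeriv i φ x) +
          ∫ x, (partialDeriv i η x * u x α) * φ x := by
      rw [← integral_add i1 i2]
      congr 1
      ext x
      rw [hd]
      ring
    have e2 : ∫ x, (η x * G x i α + partialDeriv i η x * u x α) * φ x =
        (∫ x, (η x * G x i α) * φ x) + ∫ x, (partialDeriv i η x * u x α) * φ x := by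
      rw [← integral_add i3 i2]
      congr 1
      ext x
      ring
    have e3 : ∫ x, G x i α * (η x * φ x) = ∫ x, (η x * G x i α) * φ x := by
      congr 1
      ext x
      ring
    rw [e2]
    linarith
  · intro x hx
    rw [hηφ.eq_zero_of_notMem hx, mul_zero]
  · intro x hx
    rw [(hηφ.partialDeriv i).eq_zero_of_notMem hx, mul_zero]

/-- The symmetric part of an array. -/
noncomputable def symPart (ξ : Arr d) : Arr d := fun i α => (ξ i α + ξ α i) / 2

lemma symPart_symm (ξ : Arr d) (i α : Fin d) : symPart ξ i α = symPart ξ α i := by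
  simp [symPart, add_comm]

lemma normSq_nonneg (ξ : Arr d) : 0 ≤ normSq ξ :=
  Finset.sum_nonneg fun _ _ => Finset.sum_nonneg fun _ _ => sq_nonneg _

/-- Expanding the square isolates the cross term `tr(ξ²)`, whose integral decides Korn's inequality.
-/
lemma two_mul_normSq_symPart (ξ : Arr d) :
    2 * normSq (symPart ξ) = normSq ξ + ∑ i, ∑ α, ξ i α * ξ α i := by
  have h : normSq ξ = ∑ i, ∑ α, ξ α i ^ 2 := Finset.sum_comm
  have h2 : 2 * normSq ξ = ∑ i, ∑ α, (ξ i α ^ 2 + ξ α i ^ 2) := by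
    simp only [Finset.sum_add_distrib]
    rw [← h, two_mul]
    rfl
  have h3 : 4 * normSq (symPart ξ) =
      ∑ i, ∑ α, ((ξ i α ^ 2 + ξ α i ^ 2) + 2 * (ξ i α * ξ α i)) := by
    simp only [normSq, symPart, Finset.mul_sum]
    congr! 2
    ring
  simp only [Finset.sum_add_distrib (f := fun _ => _ + _), Finset.sum_add_distrib,
    ← Finset.mul_sum] at h2 h3
  linarith

lemma integrable_normSq {μ : Measure (Sp d)} {G : Sp d → Arr d}
    (hG : ∀ i α, MemLp (fun x => G x i α) 2 μ) : Integrable (fun x => normSq (G x)) μ :=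
  integrable_finsetSum _ fun i _ => integrable_finsetSum _ fun α _ => (hG i α).integrable_sq

lemma memLp_symPart {μ : Measure (Sp d)} {G : Sp d → Arr d}
    (hG : ∀ i α, MemLp (fun x => G x i α) 2 μ) (i α : Fin d) :
    MemLp (fun x => symPart (G x) i α) 2 μ := by
  simpa only [symPart, div_eq_inv_mul, Pi.add_apply] using
    ((hG i α).add (hG α i)).const_mul (2⁻¹ : ℝ)

/-- Formally, two integrations by parts. The field with `∂_i w^α` in slot `α` and `-∂_α w^α` in slot
`i` is weakly divergence free because second derivatives of test functions commute; it is therefore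
orthogonal to the gradient of `w^i`. -/
lemma integral_mul_transpose {w : Sp d → Sp d} {W : Sp d → Arr d}
    (hw : ∀ α, IsWeakGrad (fun x => w x α) (fun i x => W x i α)) {K : Set (Sp d)}
    (hK : IsCompact K) (hwK : Function.support w ⊆ K) (i α : Fin d) :
    ∫ x, W x i α * W x α i = ∫ x, W x i i * W x α α := by
  have hL : ∀ i α, MemLp (fun x => W x i α) 2 volume := fun i α => (hw α).memLp_grad i
  have hB : ∀ k, MemLp (fun x => (if k = α then W x i α else 0) -
      (if k = i then W x α α else 0)) 2 volume := by
    intro k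
    refine MemLp.sub ?_ ?_
    · by_cases h : k = α <;> simp [h, hL]
    · by_cases h : k = i <;> simp [h, hL]
  have hsplit : ∀ f : Fin d → Sp d → ℝ, (∀ k, MemLp (f k) 2 volume) →
      ∑ k, ∫ x, ((if k = α then W x i α else 0) - (if k = i then W x α α else 0)) * f k x =
        (∫ x, W x i α * f α x) - ∫ x, W x α α * f i x := by
    intro f hf
    rw [← integral_finsetSum _ fun k _ => integrable_mul_of_memLp (hB k) (hf k),
      ← integral_sub (integrable_mul_of_memLp (hL i α) (hf α))
        (integrable_mul_of_memLp (hL α α) (hf i))]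
    congr 1
    ext x
    simp [sub_mul, Finset.sum_sub_distrib, ite_mul]
  have h := (hw i).integral_eq_zero isOpen_univ hK (subset_univ _) ?_ hB ?_
  · rw [hsplit (fun k x => W x k i) fun k => hL k i] at h
    rw [sub_eq_zero.1 h]
    congr 1
    ext x
    ring
  · intro x hx
    refine hwK fun h0 => hx ?_
    simp [h0]
  · intro v hv
    rw [hsplit (fun k => partialDeriv k v) fun k => (hv.partialDeriv k).memLp volume]
    have h1 := (hw α).weak_grad _ (hv.partialDeriv α) i
    have h2 := (hw α).weak_grad _ (hv.partialDeriv i) α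
    simp only [partialDeriv_comm hv.smooth i α] at h1
    linarith

/-- Korn's first inequality. -/
theorem integral_normSq_le_symPart {w : Sp d → Sp d} {W : Sp d → Arr d}
    (hw : ∀ α, IsWeakGrad (fun x => w x α) (fun i x => W x i α)) {K : Set (Sp d)}
    (hK : IsCompact K) (hwK : Function.support w ⊆ K) :
    ∫ x, normSq (W x) ≤ 2 * ∫ x, normSq (symPart (W x)) := by
  have hL : ∀ i α, MemLp (fun x => W x i α) 2 volume := fun i α => (hw α).memLp_grad i
  have hprod : ∀ i α j β, Integrable (fun x => W x i α * W x j β) volume :=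
    fun i α j β => (hL i α).integrable_mul (hL j β)
  -- The cross term integrates to `∫ (div w)²`.
  have hcross : 0 ≤ ∫ x, ∑ i, ∑ α, W x i α * W x α i := by
    have : ∫ x, ∑ i, ∑ α, W x i α * W x α i = ∫ x, (∑ i, W x i i) ^ 2 := by
      simp only [sq, Finset.sum_mul_sum]
      rw [integral_finsetSum _ fun i _ => integrable_finsetSum _ fun α _ => hprod _ _ _ _,
        integral_finsetSum _ fun i _ => integrable_finsetSum _ fun α _ => hprod _ _ _ _]
      refine Finset.sum_congr rfl fun i _ => ?_
      rw [integral_finsetSum _ fun α _ => hprod _ _ _ _,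
        integral_finsetSum _ fun α _ => hprod _ _ _ _]
      exact Finset.sum_congr rfl fun α _ => integral_mul_transpose hw hK hwK i α
    rw [this]
    exact integral_nonneg fun x => sq_nonneg _
  rw [← integral_const_mul]
  simp only [two_mul_normSq_symPart]
  rw [integral_add (integrable_normSq hL)
    (integrable_finsetSum _ fun i _ => integrable_finsetSum _ fun α _ => hprod _ _ _ _)]
  linarith

end HighContrast

/-! ### Algebra of the elasticity form and admissible test fields -/

namespace HighContrast

open Metric Set

variable {d : ℕ}

section Pairing

variable {a : Tensor4 d}

lemma pairing_eq_sum_flux (a : Tensor4 d) (ξ ζ : Arr d) :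
    pairing a ξ ζ = ∑ α, ∑ i, (∑ j, ∑ β, a i j α β * ξ j β) * ζ i α := by
  rw [pairing, Finset.sum_comm (s := (Finset.univ : Finset (Fin d)))]
  simp only [Finset.sum_mul]
  rw [Finset.sum_comm]
  rw [Finset.sum_comm (f := fun α i => ∑ j, ∑ β, a i j α β * ξ j β * ζ i α)]
  exact Finset.sum_congr rfl fun i _ => Finset.sum_comm

lemma pairing_add_right (a : Tensor4 d) (ξ ζ ζ' : Arr d) :
    pairing a ξ (ζ + ζ') = pairing a ξ ζ + pairing a ξ ζ' := by
  simp only [pairing, Pi.add_apply, mul_add, Finset.sum_add_distrib]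

lemma pairing_smul_right (a : Tensor4 d) (ξ ζ : Arr d) (c : ℝ) :
    pairing a ξ (c • ζ) = c * pairing a ξ ζ := by
  simp only [pairing, Pi.smul_apply, smul_eq_mul, Finset.mul_sum]
  congr! 4
  ring

lemma pairing_comm (ha : ∀ i j α β, a i j α β = a j i β α) (ξ ζ : Arr d) :
    pairing a ξ ζ = pairing a ζ ξ := by
  rw [pairing, pairing, Finset.sum_comm]
  refine Finset.sum_congr rfl fun j _ => Finset.sum_congr rfl fun i _ => ?_
  rw [Finset.sum_comm]
  refine Finset.sum_congr rfl fun β _ => Finset.sum_congr rfl fun α _ => ?_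
  rw [ha i j α β]
  ring

/-- The minor symmetry exchanges the indices `i` and `α` of the second argument. Combined with the
major symmetry, it lets ellipticity, assumed on symmetric matrices only, bound the form on all
gradients. -/
lemma pairing_symPart_right (ha : ∀ i j α β, a i j α β = a α j i β) (ξ ζ : Arr d) :
    pairing a ξ (symPart ζ) = pairing a ξ ζ := by
  have ht : pairing a ξ (fun i α => ζ α i) = pairing a ξ ζ := by
    rw [pairing_eq_sum_flux, pairing_eq_sum_flux, Finset.sum_comm]
    congr! 5 with i _ α _ j _ β
    rw [ha α j i β]
  have hs : symPart ζ = (1 / 2 : ℝ) • (ζ + fun i α => ζ α i) := by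
    ext i α
    simp only [symPart, Pi.smul_apply, Pi.add_apply, smul_eq_mul]
    ring
  rw [hs, pairing_smul_right, pairing_add_right, ht]
  ring

end Pairing

lemma normSq_symPart_le (ξ : Arr d) : normSq (symPart ξ) ≤ normSq ξ := by
  have h : 0 ≤ ∑ i, ∑ α, (ξ i α - ξ α i) ^ 2 :=
    Finset.sum_nonneg fun _ _ => Finset.sum_nonneg fun _ _ => sq_nonneg _
  have h2 : ∑ i, ∑ α, (ξ i α - ξ α i) ^ 2 =
      normSq ξ + normSq ξ - 2 * ∑ i, ∑ α, ξ i α * ξ α i := by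
    have h3 : normSq ξ = ∑ i, ∑ α, ξ α i ^ 2 := Finset.sum_comm
    nth_rewrite 2 [h3]
    simp only [normSq, ← Finset.sum_add_distrib, Finset.mul_sum, ← Finset.sum_sub_distrib]
    congr! 2
    ring
  linarith [two_mul_normSq_symPart ξ]

lemma normSq_symPart_add_le (c : ℝ) (ξ ζ : Arr d) :
    normSq (symPart (c • ξ + ζ)) ≤ 2 * (c ^ 2 * normSq (symPart ξ)) + 2 * normSq ζ := by
  refine le_trans ?_ (add_le_add_right (mul_le_mul_of_nonneg_left (normSq_symPart_le ζ)
    zero_le_two) _)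
  simp only [normSq, Finset.mul_sum, ← Finset.sum_add_distrib]
  refine Finset.sum_le_sum fun i _ => Finset.sum_le_sum fun α _ => ?_
  have : symPart (c • ξ + ζ) i α = c * symPart ξ i α + symPart ζ i α := by
    simp only [symPart, Pi.add_apply, Pi.smul_apply, smul_eq_mul]
    ring
  rw [this]
  nlinarith [sq_nonneg (c * symPart ξ i α - symPart ζ i α)]

namespace IsElasticity

variable {κ₁ κ₂ : ℝ} {A : Sp d → Tensor4 d}

lemma pairing_symPart (hA : IsElasticity κ₁ κ₂ A) (x : Sp d) (ξ : Arr d) :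
    pairing (A x) (symPart ξ) (symPart ξ) = pairing (A x) ξ ξ := by
  rw [pairing_symPart_right (hA.symm_minor x), pairing_comm (hA.symm_major x),
    pairing_symPart_right (hA.symm_minor x)]

lemma le_pairing (hA : IsElasticity κ₁ κ₂ A) (x : Sp d) (ξ : Arr d) :
    κ₁ * normSq (symPart ξ) ≤ pairing (A x) ξ ξ := by
  rw [← hA.pairing_symPart]
  exact hA.lower x _ (symPart_symm ξ)

lemma pairing_le (hA : IsElasticity κ₁ κ₂ A) (hκ₂ : 0 ≤ κ₂) (x : Sp d) (ξ : Arr d) :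
    pairing (A x) ξ ξ ≤ κ₂ * normSq ξ := by
  rw [← hA.pairing_symPart]
  exact (hA.upper x _ (symPart_symm ξ)).trans
    (mul_le_mul_of_nonneg_left (normSq_symPart_le ξ) hκ₂)

lemma pairing_nonneg (hA : IsElasticity κ₁ κ₂ A) (hκ₁ : 0 ≤ κ₁) (x : Sp d) (ξ : Arr d) :
    0 ≤ pairing (A x) ξ ξ :=
  (mul_nonneg hκ₁ (normSq_nonneg _)).trans (hA.le_pairing x ξ)

/-- The pointwise coercivity estimate behind the Caccioppoli inequality. -/
lemma le_pairing_add (hA : IsElasticity κ₁ κ₂ A) (hκ₁ : 0 ≤ κ₁) (hκ₂ : 0 ≤ κ₂) (x : Sp d)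
    (t : ℝ) (ξ ζ : Arr d) :
    κ₁ / 2 * (t ^ 2 * normSq (symPart ξ)) - 2 * κ₂ * normSq ζ ≤
      pairing (A x) ξ (t ^ 2 • ξ + (2 * t) • ζ) := by
  -- Nonnegativity at `tξ + 2ζ` gives `2t aξ·ζ ≥ -(t²/2) aξ·ξ - 2 aζ·ζ`, so half of the energy
  -- survives.
  have h0 := hA.pairing_nonneg hκ₁ x (t • ξ + (2 : ℝ) • ζ)
  rw [pairing_add_right, pairing_smul_right, pairing_smul_right,
    pairing_comm (hA.symm_major x) _ ξ, pairing_comm (hA.symm_major x) _ ζ,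
    pairing_add_right, pairing_smul_right, pairing_smul_right,
    pairing_add_right, pairing_smul_right, pairing_smul_right,
    pairing_comm (hA.symm_major x) ζ ξ] at h0
  rw [pairing_add_right, pairing_smul_right, pairing_smul_right]
  have h1 := mul_le_mul_of_nonneg_left (hA.le_pairing x ξ) (sq_nonneg t)
  have h2 := hA.pairing_le hκ₂ x ζ
  nlinarith

end IsElasticity

lemma measurable_contrast (ω : Set (Sp d)) (s : ℝ) : Measurable (contrast ω s) := by
  classical
  exact Measurable.ite isClosed_closure.isOpen_compl.measurableSet measurable_const
    measurable_const

lemma abs_contrast_le (ω : Set (Sp d)) (s : ℝ) (x : Sp d) : |contrast ω s x| ≤ max |s| 1 := by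
  unfold contrast
  split_ifs <;> simp

/-- The weak equation may be tested with compactly supported Sobolev fields. -/
theorem IsWeakSolution.integral_pairing_eq_zero {ω Ω : Set (Sp d)} {A : Sp d → Tensor4 d}
    {δ κ₁ κ₂ : ℝ} {u : Sp d → Sp d} {G : Sp d → Arr d} (hu : IsWeakSolution ω A δ Ω u G)
    (hA : IsElasticity κ₁ κ₂ A) (hΩ : IsOpen Ω) {w : Sp d → Sp d} {W : Sp d → Arr d}
    (hw : ∀ α, IsWeakGrad (fun x => w x α) (fun i x => W x i α)) {K : Set (Sp d)}
    (hK : IsCompact K) (hKΩ : K ⊆ Ω) (hwK : Function.support w ⊆ K) :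
    Integrable (fun x => contrast ω (δ ^ 2) x * pairing (A x) (G x) (W x))
        (volume.restrict Ω) ∧
      ∫ x in Ω, contrast ω (δ ^ 2) x * pairing (A x) (G x) (W x) = 0 := by
  obtain ⟨M, hM⟩ := hA.bounded
  set flux : Fin d → Fin d → Sp d → ℝ := fun i α x =>
    contrast ω (δ ^ 2) x * ∑ j, ∑ β, A x i j α β * G x j β with hflux
  have hfluxL : ∀ i α, MemLp (flux i α) 2 (volume.restrict Ω) := fun i α =>
    memLp_mul_of_bound (measurable_contrast ω _).aestronglyMeasurable (abs_contrast_le ω _)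
      (memLp_finsetSum _ fun j _ => memLp_finsetSum _ fun β _ =>
        memLp_mul_of_bound (hA.measurable i j α β).aestronglyMeasurable
          (fun x => hM x i j α β) (hu.isH1.memLp_grad j β))
  have hpair : ∀ (x : Sp d) (ζ : Arr d), contrast ω (δ ^ 2) x * pairing (A x) (G x) ζ =
      ∑ α, ∑ i, flux i α x * ζ i α := by
    intro x ζ
    simp only [pairing_eq_sum_flux, hflux, Finset.mul_sum (s := Finset.univ), Finset.sum_mul,
      mul_assoc]
  have hint : ∀ i α (f : Sp d → ℝ), MemLp f 2 volume →
      Integrable (fun x => flux i α x * f x) (volume.restrict Ω) := fun i α f hf =>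
    integrable_mul_of_memLp (hfluxL i α) (hf.restrict Ω)
  have hL : ∀ i α, MemLp (fun x => W x i α) 2 volume := fun i α => (hw α).memLp_grad i
  have hBL : ∀ i α, MemLp (Ω.indicator (flux i α)) 2 volume := fun i α =>
    (memLp_indicator_iff_restrict hΩ.measurableSet).2 (hfluxL i α)
  have hind : ∀ i α (f : Sp d → ℝ),
      ∫ x, Ω.indicator (flux i α) x * f x = ∫ x in Ω, flux i α x * f x := by
    intro i α f
    rw [← integral_indicator hΩ.measurableSet]
    congr 1
    ext x
    by_cases hx : x ∈ Ω <;> simp [hx]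
  have hα : ∀ α, ∑ i, ∫ x, Ω.indicator (flux i α) x * W x i α = 0 := by
    intro α
    refine (hw α).integral_eq_zero hΩ hK hKΩ ?_ (fun i => hBL i α) ?_
    · intro x hx
      refine hwK fun h0 => hx ?_
      simp [h0]
    · intro v hv
      -- Vector fields `v e_α` decouple the system into one scalar orthogonality relation for each
      -- `α`.
      have hV : IsTestFunction Ω fun x => v x • (EuclideanSpace.single α 1 : Sp d) :=
        ⟨hv.smooth.smul contDiff_const, hv.compact.smul_right,
          (tsupport_smul_subset_left v _).trans hv.support⟩
      have hder : ∀ i x γ, partialDeriv i (fun x => v x • (EuclideanSpace.single α 1 : Sp d)) x γ =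
          if γ = α then partialDeriv i v x else 0 := by
        intro i x γ
        simp only [partialDeriv]
        rw [fderiv_smul_const (hv.differentiable x)]
        simp
      have h := hu.eq_zero _ hV
      simp only [hpair, hder, mul_ite, mul_zero] at h
      simp only [hind]
      rw [← integral_finsetSum _ fun i _ => hint i α _ ((hv.partialDeriv i).memLp volume), ← h]
      congr 1
      ext x
      rw [Finset.sum_comm]
      simp
  constructor
  · simp only [hpair]
    exact integrable_finsetSum _ fun α _ => integrable_finsetSum _ fun i _ => hint i α _ (hL i α)
  · simp only [hpair]
    rw [integral_finsetSum _ fun α _ => integrable_finsetSum _ fun i _ => hint i α _ (hL i α)]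
    refine Finset.sum_eq_zero fun α _ => ?_
    rw [integral_finsetSum _ fun i _ => hint i α _ (hL i α), ← hα α]
    simp only [hind]

end HighContrast

/-! ### The Caccioppoli inequality, uniform in the contrast -/

namespace HighContrast

open Metric Set

variable {d : ℕ}

/-- The Caccioppoli inequality for a cutoff that is locally constant on the inclusions. -/
theorem IsWeakSolution.caccioppoli {ω Ω : Set (Sp d)} {A : Sp d → Tensor4 d}
    {δ κ₁ κ₂ : ℝ} {u : Sp d → Sp d} {G : Sp d → Arr d} (hu : IsWeakSolution ω A δ Ω u G)
    (hA : IsElasticity κ₁ κ₂ A) (hκ₁ : 0 < κ₁) (hκ₂ : 0 ≤ κ₂) (hδ : 1 ≤ δ) (hΩ : IsOpen Ω)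
    {η : Sp d → ℝ} (hη : IsTestFunction Ω η) (hηω : ∀ x ∈ ωᶜ, fderiv ℝ η x = 0) {L : ℝ}
    (hηL : ∀ x, ‖fderiv ℝ η x‖ ≤ L) {S : Set (Sp d)} (hS : IsOpen S)
    (hηS : ∀ x ∈ S, η x = 1) :
    ∫ x in S, normSq (G x) ≤
      (16 * κ₂ / κ₁ + 4) * d * L ^ 2 * ∫ x in Ω, ‖u x‖ ^ 2 := by
  set Z : Sp d → Arr d := fun x i α => partialDeriv i η x * u x α with hZ
  have hZle : ∀ x, normSq (Z x) ≤ d * L ^ 2 * ‖u x‖ ^ 2 := by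
    intro x
    have h1 : ∀ i, partialDeriv i η x ^ 2 ≤ L ^ 2 := by
      intro i
      rw [← sq_abs]
      refine pow_le_pow_left₀ (abs_nonneg _) ?_ 2
      refine ((fderiv ℝ η x).le_opNorm _).trans ?_
      simpa using hηL x
    have h2 : ‖u x‖ ^ 2 = ∑ α, u x α ^ 2 := by
      simp [EuclideanSpace.norm_sq_eq]
    calc normSq (Z x) = ∑ i, partialDeriv i η x ^ 2 * ‖u x‖ ^ 2 := by
          simp only [normSq, hZ, mul_pow, h2, Finset.mul_sum]
      _ ≤ ∑ _i : Fin d, L ^ 2 * ‖u x‖ ^ 2 :=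
          Finset.sum_le_sum fun i _ => mul_le_mul_of_nonneg_right (h1 i) (sq_nonneg _)
      _ = d * L ^ 2 * ‖u x‖ ^ 2 := by simp [mul_assoc]
  have hGL := hu.isH1.memLp_grad
  have hu2 : Integrable (fun x => ‖u x‖ ^ 2) (volume.restrict Ω) :=
    hu.isH1.memLp.integrable_norm_pow (by norm_num)
  obtain ⟨Cη, hCη⟩ := hη.exists_bound
  have hE : Integrable (fun x => η x ^ 2 * normSq (symPart (G x))) (volume.restrict Ω) := by
    have h : ∀ i α, MemLp (fun x => (η x • symPart (G x)) i α) 2 (volume.restrict Ω) :=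
      fun i α => memLp_mul_of_bound hη.smooth.continuous.aestronglyMeasurable hCη
        (memLp_symPart hGL i α)
    have heq : (fun x => η x ^ 2 * normSq (symPart (G x))) =
        fun x => normSq (η x • symPart (G x)) := by
      ext x
      simp [normSq, mul_pow, Finset.mul_sum]
    rw [heq]
    exact integrable_normSq h
  set K := tsupport η with hKdef
  have hK : IsCompact K := hη.compact
  have hη0 : ∀ x, x ∉ K → η x = 0 := fun x hx => image_eq_zero_of_notMem_tsupport hx
  -- energy estimate, testing with `η² u`
  have henergy : κ₁ / 2 * ∫ x in Ω, η x ^ 2 * normSq (symPart (G x)) ≤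
      2 * κ₂ * (d * L ^ 2) * ∫ x in Ω, ‖u x‖ ^ 2 := by
    have hηη := hη.mul hη.smooth
    have hw : ∀ α, IsWeakGrad (fun x => ((η x * η x) • u x) α)
        (fun i x => (η x ^ 2 • G x + (2 * η x) • Z x) i α) := by
      intro α
      have h := hu.isH1.isWeakGrad_mul hΩ.measurableSet hηη α
      have heq : (fun (i : Fin d) x => (η x ^ 2 • G x + (2 * η x) • Z x) i α) = fun i x =>
          η x * η x * G x i α + partialDeriv i (fun x => η x * η x) x * u x α := by
        ext i x
        rw [partialDeriv_mul (hη.differentiable x) (hη.differentiable x)]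
        simp only [hZ, Pi.add_apply, Pi.smul_apply, smul_eq_mul]
        ring
      rw [heq]
      exact h
    obtain ⟨hint, hzero⟩ := hu.integral_pairing_eq_zero hA hΩ hw hK hη.support (by
      intro x hx
      by_contra hxK
      exact hx (by simp [hη0 x hxK]))
    have hpt : ∀ x, κ₁ / 2 * (η x ^ 2 * normSq (symPart (G x))) -
        2 * κ₂ * (d * L ^ 2) * ‖u x‖ ^ 2 ≤
        contrast ω (δ ^ 2) x * pairing (A x) (G x) (η x ^ 2 • G x + (2 * η x) • Z x) := by
      intro x
      have h1 := hA.le_pairing_add hκ₁.le hκ₂ x (η x) (G x) (Z x)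
      have h2 := mul_le_mul_of_nonneg_left (hZle x) hκ₂
      -- Uniformity in `δ` comes from here: in `ω` the weight is `1`; off `ω` the cross term
      -- vanishes with `∇η`, leaving a nonnegative quantity that a weight `≥ 1` can only increase.
      by_cases hx : x ∈ ω
      · have hc : contrast ω (δ ^ 2) x = 1 := by
          simp [contrast, inclusionSet, subset_closure hx]
        rw [hc]
        linarith
      · have hZ0 : Z x = 0 := by
          ext i α
          simp [hZ, partialDeriv, hηω x hx]
        have hc : 1 ≤ contrast ω (δ ^ 2) x := by
          unfold contrast
          split_ifs
          · exact one_le_pow₀ hδ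
          · exact le_rfl
        have h3 : 0 ≤ pairing (A x) (G x) (η x ^ 2 • G x + (2 * η x) • Z x) := by
          rw [hZ0, smul_zero, add_zero, pairing_smul_right]
          exact mul_nonneg (sq_nonneg _) (hA.pairing_nonneg hκ₁.le x _)
        have h4 := le_mul_of_one_le_left h3 hc
        linarith
    have h := integral_mono (μ := volume.restrict Ω)
      ((hE.const_mul (κ₁ / 2)).sub (hu2.const_mul (2 * κ₂ * (d * L ^ 2)))) hint hpt
    rw [hzero] at h
    simp only [Pi.sub_apply] at h
    rw [integral_sub (hE.const_mul _) (hu2.const_mul _), integral_const_mul,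
      integral_const_mul] at h
    linarith
  -- Korn's inequality for `η u`
  set W : Sp d → Arr d := fun x => η x • G x + Z x with hW
  have hw : ∀ α, IsWeakGrad (fun x => (η x • u x) α) (fun i x => W x i α) :=
    fun α => hu.isH1.isWeakGrad_mul hΩ.measurableSet hη α
  have hWL : ∀ i α, MemLp (fun x => W x i α) 2 volume := fun i α => (hw α).memLp_grad i
  have hkorn := integral_normSq_le_symPart hw hK (by
    intro x hx
    by_contra hxK
    exact hx (by simp [hη0 x hxK]))
  have hWΩ : ∀ x, x ∉ Ω → normSq (symPart (W x)) = 0 := by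
    intro x hx
    have : W x = 0 := by
      ext i α
      simp [hW, hZ, hη.eq_zero_of_notMem hx, (hη.partialDeriv i).eq_zero_of_notMem hx]
    simp [this, normSq, symPart]
  rw [← setIntegral_eq_integral_of_forall_compl_eq_zero hWΩ] at hkorn
  have hsym : ∫ x in Ω, normSq (symPart (W x)) ≤
      2 * (∫ x in Ω, η x ^ 2 * normSq (symPart (G x))) +
        2 * (d * L ^ 2) * ∫ x in Ω, ‖u x‖ ^ 2 := by
    rw [← integral_const_mul, ← integral_const_mul,
      ← integral_add (hE.const_mul _) (hu2.const_mul _)]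
    refine integral_mono
      (integrable_normSq fun i α => memLp_symPart (fun i α => (hWL i α).restrict Ω) i α)
      ((hE.const_mul _).add (hu2.const_mul _)) fun x => ?_
    have h1 := normSq_symPart_add_le (η x) (G x) (Z x)
    have h2 := hZle x
    simp only [hW]
    linarith
  have hS' : ∫ x in S, normSq (G x) ≤ ∫ x, normSq (W x) := by
    have h1 : ∫ x in S, normSq (G x) = ∫ x in S, normSq (W x) := by
      refine setIntegral_congr_fun hS.measurableSet fun x hx => ?_
      have hd : fderiv ℝ η x = 0 := by
        have : η =ᶠ[nhds x] fun _ => 1 := by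
          filter_upwards [hS.mem_nhds hx] with y hy using hηS y hy
        rw [this.fderiv_eq]
        simp
      have : W x = G x := by
        ext i α
        simp [hW, hZ, hηS x hx, partialDeriv, hd]
      simp only [this]
    rw [h1]
    exact setIntegral_le_integral (integrable_normSq hWL)
      (Filter.Eventually.of_forall fun x => normSq_nonneg _)
  set I := ∫ x in Ω, ‖u x‖ ^ 2
  set J := ∫ x in Ω, η x ^ 2 * normSq (symPart (G x))
  have hJ : J ≤ 4 * κ₂ / κ₁ * (d * L ^ 2) * I := by
    rw [show 4 * κ₂ / κ₁ * (d * L ^ 2) * I = (4 * κ₂ * (d * L ^ 2) * I) / κ₁ by ring,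
      le_div_iff₀ hκ₁]
    linarith
  -- Each `4` is Korn's factor `2` times the `2` from splitting `sym (η ∇u + Z)`.
  calc ∫ x in S, normSq (G x) ≤ 4 * J + 4 * (d * L ^ 2) * I := by linarith
    _ ≤ 4 * (4 * κ₂ / κ₁ * (d * L ^ 2) * I) + 4 * (d * L ^ 2) * I := by linarith
    _ = _ := by ring

lemma cube_subset_cube {R R' : ℝ} (h : R ≤ R') : cube d R ⊆ cube d R' := fun x hx i =>
  ⟨by linarith [(hx i).1], by linarith [(hx i).2]⟩

end HighContrast

/-! ### Large and small cubes combined -/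

theorem theorem3p3 (d : ℕ) (κ₁ κ₂ : ℝ) (hκ₁ : 0 < κ₁) (hκ₂ : 0 < κ₂)
    (ω : Set (HighContrast.Sp d)) (hω : HighContrast.IsPeriodicMatrix ω)
    (ℓ : ℝ) (hℓ : 1 ≤ ℓ) :
    ∃ C : ℝ, 0 < C ∧
      ∀ (A : HighContrast.Sp d → HighContrast.Tensor4 d), HighContrast.IsElasticity κ₁ κ₂ A →
      ∀ (δ : ℝ), 1 < δ →
      ∀ (R : ℝ), 32 ≤ R →
      ∀ (u : HighContrast.Sp d → HighContrast.Sp d)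
        (gradu : HighContrast.Sp d → HighContrast.Arr d),
        HighContrast.IsWeakSolution ω A δ (HighContrast.cube d R) u gradu →
        (∫ x in HighContrast.cube d (R / 2), HighContrast.normSq (gradu x)) ≤
          C / R ^ 2 * (∫ x in HighContrast.cube d R, ‖u x‖ ^ 2) +
          C / R ^ (2 * ℓ) * (∫ x in HighContrast.cube d R, HighContrast.normSq (gradu x)) := by
  obtain ⟨R₀, L, hR₀, hL, hcut⟩ := hω.exists_cutoff
  set C₁ : ℝ := (16 * κ₂ / κ₁ + 4) * d * L ^ 2 with hC₁
  have hC₁0 : 0 ≤ C₁ := by positivity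
  have hC₂0 : 0 < R₀ ^ (2 * ℓ) := Real.rpow_pos_of_pos hR₀ _
  -- `C₁` serves `R ≥ R₀`; the summand `R₀ ^ (2 * ℓ)` makes the coefficient of the gradient term at
  -- least `1` when `R < R₀`, where the estimate is monotonicity of the integral.
  refine ⟨C₁ + R₀ ^ (2 * ℓ), by positivity, fun A hA δ hδ R hR u gradu hu => ?_⟩
  have hR0 : 0 < R := by linarith
  have hRℓ : 0 < R ^ (2 * ℓ) := Real.rpow_pos_of_pos hR0 _
  have hsub : HighContrast.cube d (R / 2) ⊆ HighContrast.cube d R :=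
    HighContrast.cube_subset_cube (by linarith)
  have hI : 0 ≤ ∫ x in HighContrast.cube d R, ‖u x‖ ^ 2 :=
    integral_nonneg fun x => sq_nonneg _
  have hJ : 0 ≤ ∫ x in HighContrast.cube d R, HighContrast.normSq (gradu x) :=
    integral_nonneg fun x => HighContrast.normSq_nonneg _
  rcases le_or_gt R₀ R with h | h
  · obtain ⟨η, hη, hη1, hηL, hηω⟩ := hcut R h
    have hcacc := hu.caccioppoli hA hκ₁ hκ₂.le hδ.le (HighContrast.isOpen_cube d R) hη hηω hηL
      (HighContrast.isOpen_cube d (R / 2)) hη1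
    rw [show (16 * κ₂ / κ₁ + 4) * d * (L / R) ^ 2 = C₁ / R ^ 2 by rw [hC₁]; ring] at hcacc
    refine hcacc.trans ((mul_le_mul_of_nonneg_right ?_ hI).trans
      (le_add_of_nonneg_right (by positivity)))
    gcongr
    linarith
  · have hle : R ^ (2 * ℓ) ≤ R₀ ^ (2 * ℓ) := Real.rpow_le_rpow hR0.le h.le (by linarith)
    have h1 : 1 ≤ (C₁ + R₀ ^ (2 * ℓ)) / R ^ (2 * ℓ) := by
      rw [one_le_div hRℓ]
      linarith
    have h2 : ∫ x in HighContrast.cube d (R / 2), HighContrast.normSq (gradu x) ≤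
        ∫ x in HighContrast.cube d R, HighContrast.normSq (gradu x) :=
      setIntegral_mono_set (HighContrast.integrable_normSq hu.isH1.memLp_grad)
        (Filter.Eventually.of_forall fun x => HighContrast.normSq_nonneg _)
        hsub.eventuallyLE
    exact (h2.trans (le_mul_of_one_le_left hJ h1)).trans
      (le_add_of_nonneg_left (by positivity))
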